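/- Let $\sigma\in\{0,\tfrac12,1,\tfrac32,\dots\}$ and let $\mathcal H=\bigoplus_{s=-\sigma,-\sigma+1,\dots,\sigma}L^2(\mathbb R^3_s,\lambda)$ (complex-valued functions, $\lambda$ Lebesgue measure, $\mathbb R^3_s$ a copy of $\mathbb R^3$) be the Hilbert space of a particle of spin $\sigma$. Let $\mathcal F\varphi(p)=(2\pi)^{-3/2}\int e^{-i\langle p,x\rangle}\varphi(x)\,dx$ be the unitary Fourier transform on $L^2(\mathbb R^3)$. Let $Z=\bigsqcup_{s}\mathbb R^6_s$ be the disjoint union of copies of $\mathbb R^6=\mathbb R^3\times\mathbb R^3$, with points $(s,q,p)$ and its Borel structure, and for a pure state $[\psi]\in\mathbb P(\mathcal H)$ with $\|\psi\|=1$, $\psi=(\psi_s)_s$, let $$\mu_{[\psi]}=\sum_{s:\ \|\psi_s\|\neq 0}\frac{1}{\|\psi_s\|^{2}}\,|\psi_s(q)|^2\,|\mathcal F\psi_s(p)|^2\cdot\lambda_{\mathbb R^6_s}.$$ A function $f:\mathbb P(\mathcal H)\times Z\to\mathbb R$, written $f_{[\psi]}=f([\psi],\cdot)$, is called an observable function with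 operator $A$ if every $f_{[\psi]}:Z\to\mathbb R$ is Borel, $A$ is a (possibly unbounded) self-adjoint operator on $\mathcal H$, and, $E^A$ being the spectral measure of $A$, $$\mu_{[\psi]}\bigl(f_{[\psi]}^{-1}(B)\bigr)=\langle\psi,E^A_B\,\psi\rangle$$ for every Borel set $B\subseteq\mathbb R$ and every unit vector $\psi\in\mathcal H$. A function on $Z$ is regarded as a function on $\mathbb P(\mathcal H)\times Z$ that does not depend on $[\psi]$. Let $Q_j$ be the operator of multiplication by $x_j$ and $P_j=-i\,\partial/\partial x_j$ ($j=1,2,3$), acting on each component $\psi_s$, on their maximal domains in $\mathcal H$, and let $S((\psi_s)_s)=(s\,\psi_s)_s$. For a Borel function $g:\mathbb R^3\to\mathbb R$ let $g(Q_1,Q_2,Q_3)=\int g\,dE$, where $E$ is the joint spectral measure of $Q_1,Q_2,Q_3$ on $\mathbb R^3$, and define $f(P_1,P_2,P_3)$ in the same way from $P_1,P_2,P_3$. Then each $\mu_{[\psi]}$ is a probability measure without atoms, and: 1. for every Borel function $f:\mathbb R^3\to\mathbb R$, the function $f(p_1,p_2,p_3)$ is an observable function with operator $f(P_1,P_2,P_3)$;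 2. for every Borel function $g:\mathbb R^3\to\mathbb R$, the function $g(q_1,q_2,q_3)$ is an observable function with operator $g(Q_1,Q_2,Q_3)$; 3. the function $s$ is an observable function with operator $S$. -/

import Mathlib

open MeasureTheory
open scoped FourierTransform SchwartzMap LineDeriv LinearAlgebra.Projectivization InnerProductSpace

noncomputable section

namespace SpinPhaseSpace

/-! ### Projection-valued measures and the functional calculus of unbounded operators -/

/-- A projection-valued measure on `X` acting on the Hilbert space `H`: orthogonal projections
`E B` (for measurable `B`) with `E X = 1`, countably additive in the strong operator topology. -/
structure PVM (X : Type*) [MeasurableSpace X] (H : Type*) [NormedAddCommGroup H]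
    [InnerProductSpace ℂ H] [CompleteSpace H] where
  /-- The projection attached to a set; only its values on measurable sets matter. -/
  proj : Set X → H →L[ℂ] H
  isStarProjection : ∀ B, MeasurableSet B → IsStarProjection (proj B)
  proj_univ : proj Set.univ = 1
  hasSum_proj : ∀ B : ℕ → Set X, (∀ i, MeasurableSet (B i)) → Pairwise (Function.onFun Disjoint B) →
    ∀ ψ : H, HasSum (fun i => proj (B i) ψ) (proj (⋃ i, B i) ψ)

section PVM

variable {X : Type*} [MeasurableSpace X] {H : Type*} [NormedAddCommGroup H]
  [InnerProductSpace ℂ H] [CompleteSpace H]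

theorem PVM.proj_empty_apply (E : PVM X H) (ψ : H) : E.proj ∅ ψ = 0 := by
  have h := E.hasSum_proj (fun _ => ∅) (fun _ => MeasurableSet.empty)
    (fun i j _ => by simp [Function.onFun]) ψ
  exact tendsto_nhds_unique tendsto_const_nhds h.summable.tendsto_atTop_zero

theorem PVM.inner_proj_nonneg (E : PVM X H) (ψ : H) {B : Set X} (hB : MeasurableSet B) :
    0 ≤ (⟪ψ, E.proj B ψ⟫_ℂ).re := by
  have hp := E.isStarProjection B hB
  have hid : E.proj B (E.proj B ψ) = E.proj B ψ := by
    have := congrArg (fun T : H →L[ℂ] H => T ψ) hp.isIdempotentElem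
    simpa using this
  have hadj : ContinuousLinearMap.adjoint (E.proj B) = E.proj B := by
    have h := hp.isSelfAdjoint
    rwa [ContinuousLinearMap.isSelfAdjoint_iff'] at h
  have h2 : ⟪ψ, E.proj B ψ⟫_ℂ = ⟪E.proj B ψ, E.proj B ψ⟫_ℂ := by
    conv_lhs => rw [← hid, ← ContinuousLinearMap.adjoint_inner_left, hadj]
  rw [h2]
  exact inner_self_nonneg (𝕜 := ℂ)

/-- The measure `B ↦ ⟨ψ, E_B ψ⟩`. -/
def PVM.measure (E : PVM X H) (ψ : H) : Measure X :=
  Measure.ofMeasurable (fun B _ => ENNReal.ofReal (⟪ψ, E.proj B ψ⟫_ℂ).re)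
    (by simp [E.proj_empty_apply])
    (by
      intro B hB hd
      have h := E.hasSum_proj B hB hd ψ
      have h2 : HasSum (fun i => (⟪ψ, E.proj (B i) ψ⟫_ℂ).re) (⟪ψ, E.proj (⋃ i, B i) ψ⟫_ℂ).re :=
        Complex.hasSum_re (h.mapL (innerSL ℂ ψ))
      rw [← h2.tsum_eq, ENNReal.ofReal_tsum_of_nonneg
        (fun i => E.inner_proj_nonneg ψ (hB i)) h2.summable])

theorem PVM.measure_apply (E : PVM X H) (ψ : H) {B : Set X} (hB : MeasurableSet B) :
    E.measure ψ B = ENNReal.ofReal (⟪ψ, E.proj B ψ⟫_ℂ).re :=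
  Measure.ofMeasurable_apply B hB

/-- `T = ∫ g dE`: the domain of `T` consists of the `ψ` with `∫ g² d⟨ψ, E ψ⟩ < ∞`, and
`⟨ψ, T ψ⟩ = ∫ g d⟨ψ, E ψ⟩` on it. As this domain is dense for measurable `g`, polarization shows
that `T` is determined by `E` and `g`. -/
def PVM.IsIntegral (E : PVM X H) (g : X → ℝ) (T : H →ₗ.[ℂ] H) : Prop :=
  (∀ ψ : H, ψ ∈ T.domain ↔ MemLp g 2 (E.measure ψ)) ∧
    ∀ ψ : T.domain, ⟪(ψ : H), T ψ⟫_ℂ = ((∫ x, g x ∂(E.measure (ψ : H)) : ℝ) : ℂ)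

/-- `E` is the spectral measure of the operator `A`, i.e. `A = ∫ r dE(r)`. -/
def IsSpectralMeasure (A : H →ₗ.[ℂ] H) (E : PVM ℝ H) : Prop :=
  E.IsIntegral (fun r => r) A

/-- `T = g(A₁, …, A_d)`: there is a joint spectral measure `E` of the operators `A₁, …, A_d`
(a projection-valued measure on `ℝ^d` with `A_j = ∫ x_j dE(x)`; it is unique when it exists)
and `T = ∫ g dE`. -/
def IsBorelFunctionOf {d : ℕ} (A : Fin d → H →ₗ.[ℂ] H) (g : EuclideanSpace ℝ (Fin d) → ℝ)
    (T : H →ₗ.[ℂ] H) : Prop :=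
  ∃ E : PVM (EuclideanSpace ℝ (Fin d)) H,
    (∀ j, E.IsIntegral (fun x => x j) (A j)) ∧ E.IsIntegral g T

/-- Given a measure `μ [ψ]` on the label space `Z` for each pure state `[ψ]`, the function
`f : ℙ(H) × Z → ℝ` is an observable function with operator `A`: each `f [ψ]` is Borel, `A` is
self-adjoint, and for every unit vector `ψ` the image of `μ [ψ]` under `f [ψ]` is the measure
`B ↦ ⟨ψ, E_B ψ⟩`, where `E` is the spectral measure of `A`. -/
def IsObservableFunction {Z : Type*} [MeasurableSpace Z] (μ : ℙ ℂ H → Measure Z)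
    (f : ℙ ℂ H → Z → ℝ) (A : H →ₗ.[ℂ] H) : Prop :=
  (∀ v, Measurable (f v)) ∧ IsSelfAdjoint A ∧
    ∃ E : PVM ℝ H, IsSpectralMeasure A E ∧
      ∀ (ψ : H) (hψ : ψ ≠ 0), ‖ψ‖ = 1 →
        (μ (Projectivization.mk ℂ ψ hψ)).map (f (Projectivization.mk ℂ ψ hψ)) = E.measure ψ

end PVM

/-! ### The particle of spin `n / 2` -/

/-- Physical space `ℝ³`. -/
abbrev R3 : Type := EuclideanSpace ℝ (Fin 3)

/-- `L²(ℝ³, λ; ℂ)`. -/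
abbrev L2R3 : Type := Lp ℂ 2 (volume : Measure R3)

/-- The Hilbert space `⨁ₛ L²(ℝ³ₛ)` of a particle of spin `σ = n / 2`; the `2σ + 1 = n + 1`
spin values `-σ, -σ + 1, …, σ` are indexed by `Fin (n + 1)`. -/
abbrev SpinSpace (n : ℕ) : Type := PiLp 2 (fun _ : Fin (n + 1) => L2R3)

/-- The spin value `s = -σ + k` with index `k`, where `σ = n / 2`. -/
def spinValue (n : ℕ) (k : Fin (n + 1)) : ℝ := (k : ℝ) - (n : ℝ) / 2

/-- The label space: the disjoint union over the spin values of copies of the phase space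
`ℝ⁶ = ℝ³ × ℝ³`, with points `(k, q, p)`. -/
abbrev LabelSpace (n : ℕ) : Type := Fin (n + 1) × R3 × R3

/-- The graph of the operator of multiplication by `x_j` on its maximal domain: the pairs `(ψ, η)`
of elements of the Hilbert space with `η_s(x) = x_j ψ_s(x)` for almost all `x`, for each `s`. -/
def positionGraph (n : ℕ) (j : Fin 3) : Submodule ℂ (SpinSpace n × SpinSpace n) where
  carrier := {a | ∀ k, a.2 k =ᵐ[volume] fun x : R3 => ((x j : ℝ) : ℂ) * a.1 k x}
  zero_mem' := fun k => by
    refine Filter.Eventually.of_forall fun x => ?_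
    change (0 : L2R3) x = _ * (0 : L2R3) x
    simp
  add_mem' := fun {a b} ha hb k => by
    filter_upwards [ha k, hb k, Lp.coeFn_add (a.1 k) (b.1 k), Lp.coeFn_add (a.2 k) (b.2 k)]
      with x h1 h2 h3 h4
    change (a.2 k + b.2 k) x = _ * (a.1 k + b.1 k) x
    rw [h3, h4, Pi.add_apply, Pi.add_apply, h1, h2, mul_add]
  smul_mem' := fun c a ha k => by
    filter_upwards [ha k, Lp.coeFn_smul c (a.1 k), Lp.coeFn_smul c (a.2 k)] with x h1 h2 h3
    change (c • a.2 k) x = _ * (c • a.1 k) x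
    rw [h2, h3, Pi.smul_apply, Pi.smul_apply, h1, smul_eq_mul, smul_eq_mul, mul_left_comm]

theorem positionGraph_functional (n : ℕ) (j : Fin 3) (a : SpinSpace n × SpinSpace n)
    (ha : a ∈ positionGraph n j) (h0 : a.1 = 0) : a.2 = 0 := by
  ext1 k
  apply Lp.ext
  filter_upwards [ha k, Lp.coeFn_zero ℂ 2 (volume : Measure R3)] with x h1 h2
  change _ = (0 : L2R3) x
  rw [h1, h0]
  change _ * (0 : L2R3) x = _
  rw [h2]
  simp

/-- The position operator `(Q_j ψ)_s (x) = x_j ψ_s(x)`, on its maximal domain. -/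
def positionOp (n : ℕ) (j : Fin 3) : SpinSpace n →ₗ.[ℂ] SpinSpace n :=
  (positionGraph n j).toLinearPMap

theorem positionOp_graph (n : ℕ) (j : Fin 3) : (positionOp n j).graph = positionGraph n j :=
  Submodule.toLinearPMap_graph_eq _ (positionGraph_functional n j)

/-- The graph of `P_j = -i ∂/∂x_j` on its maximal domain: the pairs `(ψ, η)` of elements of the
Hilbert space with `∂ψ_s/∂x_j = i η_s` in the sense of (tempered) distributions for each `s`. -/
def momentumGraph (n : ℕ) (j : Fin 3) : Submodule ℂ (SpinSpace n × SpinSpace n) where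
  carrier := {a | ∀ k, ∂_{EuclideanSpace.single j (1 : ℝ)} (Lp.toTemperedDistribution (a.1 k)) =
    Complex.I • Lp.toTemperedDistribution (a.2 k)}
  zero_mem' := fun k => by
    simp [← Lp.toTemperedDistributionCLM_apply]
  add_mem' := fun {a b} ha hb k => by
    have h1 := ha k
    have h2 := hb k
    simp only [← Lp.toTemperedDistributionCLM_apply] at h1 h2
    change ∂_{EuclideanSpace.single j (1 : ℝ)} (Lp.toTemperedDistribution (a.1 k + b.1 k)) =
      Complex.I • Lp.toTemperedDistribution (a.2 k + b.2 k)
    simp only [← Lp.toTemperedDistributionCLM_apply]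
    rw [map_add, map_add, LineDeriv.lineDerivOp_add, h1, h2, smul_add]
  smul_mem' := fun c a ha k => by
    have h1 := ha k
    simp only [← Lp.toTemperedDistributionCLM_apply] at h1
    change ∂_{EuclideanSpace.single j (1 : ℝ)} (Lp.toTemperedDistribution (c • a.1 k)) =
      Complex.I • Lp.toTemperedDistribution (c • a.2 k)
    simp only [← Lp.toTemperedDistributionCLM_apply]
    rw [map_smul, map_smul, LineDeriv.lineDerivOp_smul, h1, smul_comm]

theorem momentumGraph_functional (n : ℕ) (j : Fin 3) (a : SpinSpace n × SpinSpace n)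
    (ha : a ∈ momentumGraph n j) (h0 : a.1 = 0) : a.2 = 0 := by
  ext1 k
  have h1 := ha k
  rw [h0] at h1
  change ∂_{EuclideanSpace.single j (1 : ℝ)} (Lp.toTemperedDistribution (0 : L2R3)) = _ at h1
  simp only [← Lp.toTemperedDistributionCLM_apply] at h1
  rw [map_zero, LineDeriv.lineDerivOp_zero] at h1
  have h2 := (smul_eq_zero.1 h1.symm).resolve_left Complex.I_ne_zero
  have h3 := Lp.ker_toTemperedDistributionCLM_eq_bot (F := ℂ) (μ := (volume : Measure R3)) (p := 2)
  exact LinearMap.ker_eq_bot'.1 h3 _ h2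

/-- The momentum operator `P_j = -i ∂/∂x_j` on its maximal domain (units with `ħ = 1`). -/
def momentumOp (n : ℕ) (j : Fin 3) : SpinSpace n →ₗ.[ℂ] SpinSpace n :=
  (momentumGraph n j).toLinearPMap

theorem momentumOp_graph (n : ℕ) (j : Fin 3) : (momentumOp n j).graph = momentumGraph n j :=
  Submodule.toLinearPMap_graph_eq _ (momentumGraph_functional n j)

/-- The spin operator `S (ψ_s)_s = (s ψ_s)_s`, defined on the whole space. -/
def spinOp (n : ℕ) : SpinSpace n →ₗ.[ℂ] SpinSpace n :=
  LinearMap.toPMap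
    { toFun := fun ψ => WithLp.toLp 2 fun k => ((spinValue n k : ℝ) : ℂ) • ψ k
      map_add' := fun a b => by ext1 k; simp
      map_smul' := fun c a => by ext1 k; simpa using smul_comm _ _ _ } ⊤

/-- The unitary Fourier transform `(F φ)(p) = (2π)^(-3/2) ∫ exp(-i⟨p, x⟩) φ(x) dx`, extended to
`L²` by continuity. Mathlib's transform on `L²` has the kernel `exp(-2πi⟨ξ, x⟩)`, whence
`(F φ)(p) = (2π)^(-3/2) (𝓕 φ)(p / 2π)`. -/
def unitaryFourier (φ : L2R3) (p : R3) : ℂ :=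
  (((2 * Real.pi) ^ (-(3 / 2) : ℝ) : ℝ) : ℂ) * (𝓕 φ : L2R3) ((2 * Real.pi)⁻¹ • p)

open Classical in
/-- For a unit vector `ψ`, the measure on the label space which on the sheet `ℝ⁶ₛ` has the
Lebesgue density `‖ψ_s‖⁻² |ψ_s(q)|² |(F ψ_s)(p)|²` if `ψ_s ≠ 0`, and vanishes if `ψ_s = 0`. -/
def vectorMeasure (n : ℕ) (ψ : SpinSpace n) : Measure (LabelSpace n) :=
  ∑ k ∈ Finset.univ.filter (fun k => ψ k ≠ 0),
    ((volume : Measure (R3 × R3)).withDensity fun z =>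
      ENNReal.ofReal ((‖ψ k‖ ^ 2)⁻¹ * (‖ψ k z.1‖ ^ 2 * ‖unitaryFourier (ψ k) z.2‖ ^ 2))).map
        (fun z => (k, z))

/-- The measure `μ [ψ]`, obtained from a unit vector representing `[ψ]`. -/
def stateMeasure (n : ℕ) (v : ℙ ℂ (SpinSpace n)) : Measure (LabelSpace n) :=
  vectorMeasure n (((‖v.rep‖⁻¹ : ℝ) : ℂ) • v.rep)

theorem unitaryFourier_smul_ae (c : ℂ) (φ : L2R3) :
    unitaryFourier (c • φ) =ᵐ[volume] fun p => c * unitaryFourier φ p := by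
  have h : (𝓕 (c • φ) : L2R3) =ᵐ[volume] c • (𝓕 φ : L2R3) := by
    rw [FourierTransform.fourier_smul]
    exact Lp.coeFn_smul c _
  have hpi : (2 * Real.pi)⁻¹ ≠ 0 := by positivity
  filter_upwards [(Measure.quasiMeasurePreserving_smul (volume : Measure R3) hpi).ae h] with p hp
  simp only [unitaryFourier]
  rw [hp, Pi.smul_apply, smul_eq_mul, mul_left_comm]

theorem vectorMeasure_smul (n : ℕ) (c : ℂ) (hc : ‖c‖ = 1) (ψ : SpinSpace n) :
    vectorMeasure n (c • ψ) = vectorMeasure n ψ := by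
  classical
  have hc0 : c ≠ 0 := by
    rintro rfl
    simp at hc
  unfold vectorMeasure
  have hf : Finset.univ.filter (fun k => (c • ψ) k ≠ 0) = Finset.univ.filter (fun k => ψ k ≠ 0) := by
    ext k
    simp [hc0]
  refine Finset.sum_congr (by convert hf) fun k _ => ?_
  congr 1
  apply withDensity_congr_ae
  have h1 : ∀ᵐ z : R3 × R3, (c • ψ k) z.1 = c * ψ k z.1 :=
    Measure.quasiMeasurePreserving_fst.ae (Lp.coeFn_smul c (ψ k))
  have h2 : ∀ᵐ z : R3 × R3, unitaryFourier (c • ψ k) z.2 = c * unitaryFourier (ψ k) z.2 :=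
    Measure.quasiMeasurePreserving_snd.ae (unitaryFourier_smul_ae c (ψ k))
  filter_upwards [h1, h2] with z hz1 hz2
  rw [PiLp.smul_apply, hz1, hz2, norm_smul, norm_mul, norm_mul, hc, one_mul, one_mul, one_mul]

/-- The measure of a state does not depend on the choice of the representing unit vector. -/
theorem stateMeasure_mk (n : ℕ) (ψ : SpinSpace n) (hψ : ψ ≠ 0) (h1 : ‖ψ‖ = 1) :
    stateMeasure n (Projectivization.mk ℂ ψ hψ) = vectorMeasure n ψ := by
  obtain ⟨a, ha⟩ := Projectivization.exists_smul_eq_mk_rep ℂ ψ hψ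
  have ha0 : ‖(a : ℂ)‖ ≠ 0 := norm_ne_zero_iff.2 a.ne_zero
  unfold stateMeasure
  rw [← ha, Units.smul_def, smul_smul]
  apply vectorMeasure_smul
  rw [norm_smul, h1, mul_one, norm_mul, Complex.norm_real, norm_inv, norm_norm,
    inv_mul_cancel₀ ha0]

end SpinPhaseSpace

end

open SpinPhaseSpace

noncomputable section

namespace SpinPhaseSpace

/-! ### Hilbert space preliminaries -/

section Hilbert

variable {H : Type*} [NormedAddCommGroup H] [InnerProductSpace ℂ H]

/-! Everything reduces to multiplication operators. On `⨁ₛ L²(ℝ³)` the indicators of sets of points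
`(s, x)` act as projections and form a projection-valued measure, `multiplicationPVM`, whose measure
for `ψ` has density `|ψ_s(x)|²` on sheet `s`. Multiplication by a real measurable `g` on its maximal
domain is self-adjoint (`isSelfAdjoint_mulOp`) and equals `∫ g dE` (`isIntegral_mulOp`). Position
and spin are such operators. Momentum is the Fourier conjugate of multiplication by `2π p_j`,
because the Fourier transform diagonalizes the distributional derivative
(`lineDeriv_toTemperedDistribution_eq_iff`).

On the probabilistic side, each sheet carries a normalized product density. Integrating out `p`
yields the factor `‖F ψ_s‖² = ‖ψ_s‖²` by Plancherel, which cancels the normalization and leaves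
`|ψ_s(q)|²`; integrating out `q` likewise leaves `|F ψ_s(p)|²`. Hence the joint law of `(s, q)` is
the measure given by `positionPVM`, and that of `(s, p)` the one given by `momentumPVM`. Pushing
these laws forward along a real function gives the law required of the corresponding operator
(`PVM.isObservableFunction_of_isIntegral`). -/

theorem hasSum_of_orthogonal {ι : Type*} {v : ι → H} {w : H}
    (horth : ∀ i j, i ≠ j → ⟪v i, v j⟫_ℂ = 0) (hw : ∀ i, ⟪v i, w⟫_ℂ = ⟪v i, v i⟫_ℂ)
    (hsum : HasSum (fun i => ‖v i‖ ^ 2) (‖w‖ ^ 2)) : HasSum v w := by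
  -- Pythagoras: by `hw` each `v i` is orthogonal to `w - v i`, so the finite sum is the projection
  -- of `w` onto the span of its terms.
  have key : ∀ F : Finset ι, ‖∑ i ∈ F, v i - w‖ ^ 2 = ‖w‖ ^ 2 - ∑ i ∈ F, ‖v i‖ ^ 2 := by
    intro F
    have h1 : ⟪∑ i ∈ F, v i, w⟫_ℂ = ((∑ i ∈ F, ‖v i‖ ^ 2 : ℝ) : ℂ) := by
      rw [sum_inner]
      push_cast
      exact Finset.sum_congr rfl fun i _ => by rw [hw, inner_self_eq_norm_sq_to_K]; rfl
    have h2 : ⟪∑ i ∈ F, v i, ∑ i ∈ F, v i⟫_ℂ = ((∑ i ∈ F, ‖v i‖ ^ 2 : ℝ) : ℂ) := by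
      rw [sum_inner]
      push_cast
      refine Finset.sum_congr rfl fun i hi => ?_
      rw [inner_sum, Finset.sum_eq_single_of_mem i hi fun j _ hj => horth i j hj.symm,
        inner_self_eq_norm_sq_to_K]
      rfl
    have h3 : ‖∑ i ∈ F, v i‖ ^ 2 = ∑ i ∈ F, ‖v i‖ ^ 2 := by
      rw [inner_self_eq_norm_sq_to_K] at h2
      exact Complex.ofReal_injective (by simpa using h2)
    rw [norm_sub_sq (𝕜 := ℂ), h1, h3, RCLike.re_eq_complex_re, Complex.ofReal_re]
    ring
  rw [HasSum, SummationFilter.unconditional_filter] at hsum ⊢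
  rw [tendsto_iff_norm_sub_tendsto_zero]
  have h4 : Filter.Tendsto (fun F : Finset ι => ‖∑ i ∈ F, v i - w‖ ^ 2) Filter.atTop (nhds 0) := by
    simp_rw [key]
    have h5 := hsum.const_sub (‖w‖ ^ 2)
    rwa [sub_self] at h5
  simpa [Real.sqrt_sq] using h4.sqrt

variable [CompleteSpace H]

/-- A densely defined operator is self-adjoint if its graph is its own adjoint relation. -/
theorem isSelfAdjoint_of_mem_graph_iff {A : H →ₗ.[ℂ] H} (hd : Dense (A.domain : Set H))
    (h : ∀ x : H × H, x ∈ A.graph ↔ ∀ a b, (a, b) ∈ A.graph → ⟪b, x.1⟫_ℂ = ⟪a, x.2⟫_ℂ) :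
    IsSelfAdjoint A := by
  rw [LinearPMap.isSelfAdjoint_def]
  apply LinearPMap.eq_of_eq_graph
  rw [LinearPMap.adjoint_graph_eq_graph_adjoint hd]
  ext x
  rw [Submodule.mem_adjoint_iff, h]
  simp only [sub_eq_zero]

theorem mem_graph_iff_of_isSelfAdjoint {A : H →ₗ.[ℂ] H} (hA : IsSelfAdjoint A) (x : H × H) :
    x ∈ A.graph ↔ ∀ a b, (a, b) ∈ A.graph → ⟪b, x.1⟫_ℂ = ⟪a, x.2⟫_ℂ := by
  conv_lhs => rw [← LinearPMap.isSelfAdjoint_def.1 hA,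
    LinearPMap.adjoint_graph_eq_graph_adjoint hA.dense_domain, Submodule.mem_adjoint_iff]
  simp only [sub_eq_zero]

end Hilbert

/-! ### Unitary conjugates of unbounded operators -/

section Conjugate

variable {H K : Type*} [NormedAddCommGroup H] [InnerProductSpace ℂ H]
  [NormedAddCommGroup K] [InnerProductSpace ℂ K]

/-- The graph of the conjugate `U⁻¹ A U`. -/
def conjGraph (A : K →ₗ.[ℂ] K) (U : H ≃ₗᵢ[ℂ] K) : Submodule ℂ (H × H) :=
  A.graph.comap ((U.toLinearEquiv : H →ₗ[ℂ] K).prodMap (U.toLinearEquiv : H →ₗ[ℂ] K))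

theorem mem_conjGraph (A : K →ₗ.[ℂ] K) (U : H ≃ₗᵢ[ℂ] K) (x : H × H) :
    x ∈ conjGraph A U ↔ (U x.1, U x.2) ∈ A.graph :=
  Iff.rfl

/-- The conjugate `U⁻¹ A U` of an operator by a unitary map. -/
def conjOp (A : K →ₗ.[ℂ] K) (U : H ≃ₗᵢ[ℂ] K) : H →ₗ.[ℂ] H :=
  (conjGraph A U).toLinearPMap

theorem conjOp_graph (A : K →ₗ.[ℂ] K) (U : H ≃ₗᵢ[ℂ] K) : (conjOp A U).graph = conjGraph A U := by
  refine Submodule.toLinearPMap_graph_eq _ fun x hx h0 => ?_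
  have hx' := (mem_conjGraph A U x).1 hx
  rw [h0, map_zero] at hx'
  exact (U.map_eq_zero_iff).1 (LinearPMap.graph_fst_eq_zero_snd A hx' rfl)

theorem mem_conjOp_domain (A : K →ₗ.[ℂ] K) (U : H ≃ₗᵢ[ℂ] K) (ψ : H) :
    ψ ∈ (conjOp A U).domain ↔ U ψ ∈ A.domain := by
  rw [LinearPMap.mem_domain_iff, LinearPMap.mem_domain_iff, conjOp_graph]
  simp only [mem_conjGraph]
  exact ⟨fun ⟨y, hy⟩ => ⟨_, hy⟩, fun ⟨y, hy⟩ => ⟨U.symm y, by simpa using hy⟩⟩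

end Conjugate

/-! ### Images and conjugates of projection-valued measures -/

section Transport

variable {X Y : Type*} [MeasurableSpace X] [MeasurableSpace Y]
  {H K : Type*} [NormedAddCommGroup H] [InnerProductSpace ℂ H] [CompleteSpace H]
  [NormedAddCommGroup K] [InnerProductSpace ℂ K] [CompleteSpace K]

/-- The image of a projection-valued measure under a measurable map. -/
def PVM.map (E : PVM X H) (f : X → Y) (hf : Measurable f) : PVM Y H where
  proj B := E.proj (f ⁻¹' B)
  isStarProjection B hB := E.isStarProjection _ (hf hB)
  proj_univ := by rw [Set.preimage_univ, E.proj_univ]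
  hasSum_proj B hB hd ψ := by
    rw [Set.preimage_iUnion]
    exact E.hasSum_proj _ (fun i => hf (hB i)) (fun i j hij => (hd hij).preimage f) ψ

theorem PVM.map_measure (E : PVM X H) {f : X → Y} (hf : Measurable f) (ψ : H) :
    (E.map f hf).measure ψ = (E.measure ψ).map f := by
  ext B hB
  rw [Measure.map_apply hf hB, PVM.measure_apply _ _ hB, PVM.measure_apply _ _ (hf hB)]
  rfl

theorem PVM.isIntegral_map_iff (E : PVM X H) {f : X → Y} (hf : Measurable f) {g : Y → ℝ}
    (hg : Measurable g) (T : H →ₗ.[ℂ] H) :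
    (E.map f hf).IsIntegral g T ↔ E.IsIntegral (fun x => g (f x)) T := by
  have h1 : ∀ ψ : H, MemLp g 2 ((E.map f hf).measure ψ) ↔
      MemLp (fun x => g (f x)) 2 (E.measure ψ) := fun ψ => by
    rw [E.map_measure hf, memLp_map_measure_iff hg.aestronglyMeasurable hf.aemeasurable]
    rfl
  have h2 : ∀ ψ : H, ∫ y, g y ∂((E.map f hf).measure ψ) = ∫ x, g (f x) ∂(E.measure ψ) := fun ψ => by
    rw [E.map_measure hf, integral_map hf.aemeasurable hg.aestronglyMeasurable]
  simp only [PVM.IsIntegral, h1, h2]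

/-- The conjugate of a projection-valued measure by a unitary map. -/
def PVM.conj (E : PVM X K) (U : H ≃ₗᵢ[ℂ] K) : PVM X H where
  proj B := (U.symm.toContinuousLinearEquiv : K →L[ℂ] H) ∘L E.proj B ∘L
    (U.toContinuousLinearEquiv : H →L[ℂ] K)
  isStarProjection B hB := by
    have hp := E.isStarProjection B hB
    have hid : ∀ ψ, E.proj B (E.proj B ψ) = E.proj B ψ := fun ψ => by
      simpa using congrArg (fun T : K →L[ℂ] K => T ψ) hp.isIdempotentElem
    have hadj : ∀ φ ψ, ⟪E.proj B φ, ψ⟫_ℂ = ⟪φ, E.proj B ψ⟫_ℂ := fun φ ψ => by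
      conv_lhs => rw [← ContinuousLinearMap.isSelfAdjoint_iff'.1 hp.isSelfAdjoint,
        ContinuousLinearMap.adjoint_inner_left]
    refine ⟨?_, ?_⟩
    · ext ψ
      simp [hid]
    · rw [ContinuousLinearMap.isSelfAdjoint_iff', eq_comm, ContinuousLinearMap.eq_adjoint_iff]
      intro φ ψ
      change ⟪U.symm (E.proj B (U φ)), ψ⟫_ℂ = ⟪φ, U.symm (E.proj B (U ψ))⟫_ℂ
      rw [← U.inner_map_map, ← U.inner_map_map φ, U.apply_symm_apply, U.apply_symm_apply, hadj]
  proj_univ := by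
    ext ψ
    simp [E.proj_univ]
  hasSum_proj B hB hd ψ :=
    (E.hasSum_proj B hB hd (U ψ)).mapL (U.symm.toContinuousLinearEquiv : K →L[ℂ] H)

theorem PVM.conj_measure (E : PVM X K) (U : H ≃ₗᵢ[ℂ] K) (ψ : H) :
    (E.conj U).measure ψ = E.measure (U ψ) := by
  ext B hB
  rw [PVM.measure_apply _ _ hB, PVM.measure_apply _ _ hB]
  change ENNReal.ofReal (⟪ψ, U.symm (E.proj B (U ψ))⟫_ℂ).re = _
  rw [← U.inner_map_map, U.apply_symm_apply]

/-- A unitary is a homeomorphism, so the domain stays dense, and it preserves inner products, so the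
adjoint relation of the graph is carried over. -/
theorem isSelfAdjoint_conjOp {A : K →ₗ.[ℂ] K} (hA : IsSelfAdjoint A) (U : H ≃ₗᵢ[ℂ] K) :
    IsSelfAdjoint (conjOp A U) := by
  apply isSelfAdjoint_of_mem_graph_iff
  · have h : ((conjOp A U).domain : Set H) = U.toHomeomorph ⁻¹' (A.domain : Set K) :=
      Set.ext fun ψ => mem_conjOp_domain A U ψ
    rw [h]
    exact hA.dense_domain.preimage U.toHomeomorph.isOpenMap
  · intro x
    rw [conjOp_graph, mem_conjGraph, mem_graph_iff_of_isSelfAdjoint hA]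
    simp only [mem_conjGraph]
    constructor
    · intro h a b hab
      simpa using h _ _ hab
    · intro h a b hab
      have := h (U.symm a) (U.symm b) (by simpa using hab)
      rw [← U.inner_map_map, ← U.inner_map_map (U.symm a)] at this
      simpa using this

theorem PVM.IsIntegral.conj {E : PVM X K} {g : X → ℝ} {A : K →ₗ.[ℂ] K} (h : E.IsIntegral g A)
    (U : H ≃ₗᵢ[ℂ] K) : (E.conj U).IsIntegral g (conjOp A U) := by
  refine ⟨fun ψ => ?_, fun ψ => ?_⟩
  · rw [mem_conjOp_domain, h.1, E.conj_measure]
  · have hg : (U ψ, U (conjOp A U ψ)) ∈ A.graph := by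
      have := LinearPMap.mem_graph (conjOp A U) ψ
      rwa [conjOp_graph] at this
    obtain ⟨y, hy, hy'⟩ := A.mem_graph_iff.1 hg
    simp only at hy hy'
    rw [E.conj_measure, ← U.inner_map_map, ← hy, ← hy', h.2]

end Transport

/-! ### Multiplication operators on a finite direct sum of `L²` spaces -/

section Multiplication

variable {ι α : Type*} [MeasurableSpace α] {μ : Measure α}

/-- Multiplication by the indicator function of a measurable set on `L²`. -/
def indicatorL (μ : Measure α) {s : Set α} (hs : MeasurableSet s) : Lp ℂ 2 μ →L[ℂ] Lp ℂ 2 μ :=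
  LinearMap.mkContinuous
    { toFun := fun f => ((Lp.memLp f).indicator hs).toLp _
      map_add' := fun f g => by
        rw [← MemLp.toLp_add]
        apply MemLp.toLp_congr
        filter_upwards [Lp.coeFn_add f g] with x hx
        simp only [Set.indicator, Pi.add_apply]
        split_ifs
        · exact hx
        · simp
      map_smul' := fun c f => by
        rw [RingHom.id_apply, ← MemLp.toLp_const_smul]
        apply MemLp.toLp_congr
        filter_upwards [Lp.coeFn_smul c f] with x hx
        simp only [Set.indicator, Pi.smul_apply]
        split_ifs
        · exact hx
        · simp }
    1 fun f => by
      rw [one_mul]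
      apply Lp.norm_le_norm_of_ae_le
      filter_upwards [((Lp.memLp f).indicator hs).coeFn_toLp] with x hx
      simp only [LinearMap.coe_mk, AddHom.coe_mk]
      rw [hx]
      exact norm_indicator_le_norm_self _ _

theorem coeFn_indicatorL {s : Set α} (hs : MeasurableSet s) (f : Lp ℂ 2 μ) :
    indicatorL μ hs f =ᵐ[μ] s.indicator f :=
  ((Lp.memLp f).indicator hs).coeFn_toLp

variable [MeasurableSpace ι]

open Classical in
/-- Multiplication by the indicator function of a set `B ⊆ ι × α` on `⨁ᵢ L²(α)`. -/
def sectionProj (μ : Measure α) (B : Set (ι × α)) :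
    PiLp 2 (fun _ : ι => Lp ℂ 2 μ) →L[ℂ] PiLp 2 (fun _ : ι => Lp ℂ 2 μ) :=
  -- The value `0` on non-measurable sets is arbitrary: a `PVM` is constrained only on measurable
  -- sets.
  if h : MeasurableSet B then
    ((PiLp.continuousLinearEquiv 2 ℂ (fun _ : ι => Lp ℂ 2 μ)).symm :
        (ι → Lp ℂ 2 μ) →L[ℂ] PiLp 2 (fun _ : ι => Lp ℂ 2 μ)) ∘L
      ContinuousLinearMap.pi fun k =>
        indicatorL μ (measurable_prodMk_left (x := k) h) ∘L PiLp.proj 2 (fun _ : ι => Lp ℂ 2 μ) k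
  else 0

theorem coeFn_sectionProj {B : Set (ι × α)} (hB : MeasurableSet B)
    (ψ : PiLp 2 (fun _ : ι => Lp ℂ 2 μ)) (k : ι) :
    sectionProj μ B ψ k =ᵐ[μ] (Prod.mk k ⁻¹' B).indicator (ψ k) := by
  rw [sectionProj, dif_pos hB]
  exact coeFn_indicatorL (measurable_prodMk_left hB) (ψ k)

theorem sectionProj_comp {B C : Set (ι × α)} (hB : MeasurableSet B) (hC : MeasurableSet C)
    (ψ : PiLp 2 (fun _ : ι => Lp ℂ 2 μ)) :
    sectionProj μ B (sectionProj μ C ψ) = sectionProj μ (B ∩ C) ψ := by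
  ext1 k
  apply Lp.ext
  filter_upwards [coeFn_sectionProj hB (sectionProj μ C ψ) k, coeFn_sectionProj hC ψ k,
    coeFn_sectionProj (hB.inter hC) ψ k] with x h1 h2 h3
  rw [h1, h3, Set.preimage_inter, ← Set.indicator_indicator]
  simp only [Set.indicator]
  split_ifs
  · rw [h2, Set.indicator_of_mem (by assumption)]
  · rw [h2, Set.indicator_of_notMem (by assumption)]
  · rfl

variable [Fintype ι]

theorem inner_sectionProj_right {B : Set (ι × α)} (hB : MeasurableSet B)
    (φ ψ : PiLp 2 (fun _ : ι => Lp ℂ 2 μ)) :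
    ⟪φ, sectionProj μ B ψ⟫_ℂ = ∑ k, ∫ x in Prod.mk k ⁻¹' B, ⟪φ k x, ψ k x⟫_ℂ ∂μ := by
  rw [PiLp.inner_apply]
  refine Finset.sum_congr rfl fun k _ => ?_
  rw [L2.inner_def, ← integral_indicator (measurable_prodMk_left hB)]
  apply integral_congr_ae
  filter_upwards [coeFn_sectionProj hB ψ k] with x hx
  rw [hx]
  simp only [Set.indicator]
  split_ifs <;> simp

theorem inner_sectionProj_left {B : Set (ι × α)} (hB : MeasurableSet B)
    (φ ψ : PiLp 2 (fun _ : ι => Lp ℂ 2 μ)) :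
    ⟪sectionProj μ B φ, ψ⟫_ℂ = ⟪φ, sectionProj μ B ψ⟫_ℂ := by
  rw [inner_sectionProj_right hB, PiLp.inner_apply]
  refine Finset.sum_congr rfl fun k _ => ?_
  rw [L2.inner_def, ← integral_indicator (measurable_prodMk_left hB)]
  apply integral_congr_ae
  filter_upwards [coeFn_sectionProj hB φ k] with x hx
  rw [hx]
  simp only [Set.indicator]
  split_ifs <;> simp

theorem inner_sectionProj_self {B : Set (ι × α)} (hB : MeasurableSet B)
    (ψ : PiLp 2 (fun _ : ι => Lp ℂ 2 μ)) :
    ⟪ψ, sectionProj μ B ψ⟫_ℂ = ((‖sectionProj μ B ψ‖ ^ 2 : ℝ) : ℂ) := by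
  have h := inner_self_eq_norm_sq_to_K (𝕜 := ℂ) (sectionProj μ B ψ)
  rw [inner_sectionProj_left hB, sectionProj_comp hB hB, Set.inter_self] at h
  push_cast
  exact h

theorem norm_sectionProj_sq {B : Set (ι × α)} (hB : MeasurableSet B)
    (ψ : PiLp 2 (fun _ : ι => Lp ℂ 2 μ)) :
    ‖sectionProj μ B ψ‖ ^ 2 = ∑ k, ∫ x in Prod.mk k ⁻¹' B, ‖ψ k x‖ ^ 2 ∂μ := by
  apply Complex.ofReal_injective
  rw [← inner_sectionProj_self hB, inner_sectionProj_right hB]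
  push_cast
  refine (Finset.sum_congr rfl fun k _ => ?_)
  rw [← integral_complex_ofReal]
  congr 1 with x
  rw [inner_self_eq_norm_sq_to_K]
  push_cast
  rfl

/-- The projection-valued measure on `ι × α` acting on `⨁ᵢ L²(α)` by multiplication. -/
def multiplicationPVM (ι : Type*) [MeasurableSpace ι] [Fintype ι] (μ : Measure α) :
    PVM (ι × α) (PiLp 2 (fun _ : ι => Lp ℂ 2 μ)) where
  proj := sectionProj μ
  isStarProjection B hB := by
    refine ⟨?_, ?_⟩
    · ext1 ψ
      exact (sectionProj_comp hB hB ψ).trans (by rw [Set.inter_self])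
    · rw [ContinuousLinearMap.isSelfAdjoint_iff', eq_comm, ContinuousLinearMap.eq_adjoint_iff]
      exact inner_sectionProj_left hB
  proj_univ := by
    ext1 ψ
    ext1 k
    apply Lp.ext
    filter_upwards [coeFn_sectionProj MeasurableSet.univ ψ k] with x hx
    rw [hx]
    simp
  hasSum_proj B hB hd ψ := by
    have hU := MeasurableSet.iUnion hB
    -- Disjoint sets give orthogonal vectors, so strong additivity reduces to countable additivity
    -- of the integrals of `‖ψ k x‖ ^ 2`.
    apply hasSum_of_orthogonal
    · intro i j hij
      rw [inner_sectionProj_left (hB i), sectionProj_comp (hB i) (hB j),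
        inner_sectionProj_right ((hB i).inter (hB j)), (hd hij).inter_eq]
      simp
    · intro i
      rw [inner_sectionProj_left (hB i), sectionProj_comp (hB i) hU,
        Set.inter_eq_left.2 (Set.subset_iUnion B i), inner_sectionProj_left (hB i),
        sectionProj_comp (hB i) (hB i), Set.inter_self]
    · simp only [norm_sectionProj_sq, hB, hU]
      refine hasSum_sum fun k _ => ?_
      rw [Set.preimage_iUnion]
      refine hasSum_integral_iUnion (fun i => measurable_prodMk_left (hB i))
        (fun i j hij => (hd hij).preimage _) ?_
      exact ((memLp_two_iff_integrable_sq_norm (Lp.aestronglyMeasurable _)).1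
        (Lp.memLp (ψ k))).integrableOn

theorem multiplicationPVM_measure (ψ : PiLp 2 (fun _ : ι => Lp ℂ 2 μ)) :
    (multiplicationPVM ι μ).measure ψ =
      ∑ k, (μ.withDensity fun x => ENNReal.ofReal (‖ψ k x‖ ^ 2)).map (Prod.mk k) := by
  ext B hB
  rw [PVM.measure_apply _ _ hB]
  change ENNReal.ofReal (⟪ψ, sectionProj μ B ψ⟫_ℂ).re = _
  rw [inner_sectionProj_self hB, Complex.ofReal_re, norm_sectionProj_sq hB, Measure.finsetSum_apply,
    ENNReal.ofReal_sum_of_nonneg fun k _ => integral_nonneg fun x => by positivity]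
  refine Finset.sum_congr rfl fun k _ => ?_
  have hk : MeasurableSet (Prod.mk k ⁻¹' B) := measurable_prodMk_left hB
  rw [Measure.map_apply measurable_prodMk_left hB, withDensity_apply _ hk,
    ofReal_integral_eq_lintegral_ofReal _ (Filter.Eventually.of_forall fun x => by positivity)]
  exact ((memLp_two_iff_integrable_sq_norm (Lp.aestronglyMeasurable _)).1
        (Lp.memLp (ψ k))).integrableOn

end Multiplication

/-! ### Multiplication by a real function: self-adjointness and spectral integral. -/

section MultiplicationOp

variable {ι α : Type*} [MeasurableSpace α] {μ : Measure α}

/-- The graph of multiplication by `g` on its maximal domain in `⨁ᵢ L²(α)`. -/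
def mulGraph (μ : Measure α) (g : ι × α → ℝ) :
    Submodule ℂ (PiLp 2 (fun _ : ι => Lp ℂ 2 μ) × PiLp 2 (fun _ : ι => Lp ℂ 2 μ)) where
  carrier := {a | ∀ k, a.2 k =ᵐ[μ] fun x => (g (k, x) : ℂ) * a.1 k x}
  zero_mem' := fun k => by
    filter_upwards [Lp.coeFn_zero ℂ 2 μ] with x hx
    change (0 : Lp ℂ 2 μ) x = _ * (0 : Lp ℂ 2 μ) x
    rw [hx]
    simp
  add_mem' := fun {a b} ha hb k => by
    filter_upwards [ha k, hb k, Lp.coeFn_add (a.1 k) (b.1 k), Lp.coeFn_add (a.2 k) (b.2 k)]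
      with x h1 h2 h3 h4
    change (a.2 k + b.2 k) x = _ * (a.1 k + b.1 k) x
    rw [h3, h4, Pi.add_apply, Pi.add_apply, h1, h2, mul_add]
  smul_mem' := fun c a ha k => by
    filter_upwards [ha k, Lp.coeFn_smul c (a.1 k), Lp.coeFn_smul c (a.2 k)] with x h1 h2 h3
    change (c • a.2 k) x = _ * (c • a.1 k) x
    rw [h2, h3, Pi.smul_apply, Pi.smul_apply, h1, smul_eq_mul, smul_eq_mul, mul_left_comm]

theorem mem_mulGraph (g : ι × α → ℝ)
    (a : PiLp 2 (fun _ : ι => Lp ℂ 2 μ) × PiLp 2 (fun _ : ι => Lp ℂ 2 μ)) :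
    a ∈ mulGraph μ g ↔ ∀ k, a.2 k =ᵐ[μ] fun x => (g (k, x) : ℂ) * a.1 k x :=
  Iff.rfl

theorem mulGraph_functional (g : ι × α → ℝ)
    (a : PiLp 2 (fun _ : ι => Lp ℂ 2 μ) × PiLp 2 (fun _ : ι => Lp ℂ 2 μ))
    (ha : a ∈ mulGraph μ g) (h0 : a.1 = 0) : a.2 = 0 := by
  ext1 k
  apply Lp.ext
  filter_upwards [ha k, Lp.coeFn_zero ℂ 2 μ] with x h1 h2
  change _ = (0 : Lp ℂ 2 μ) x
  rw [h1, h0]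
  change _ * (0 : Lp ℂ 2 μ) x = _
  rw [h2]
  simp

/-- Multiplication by `g` on its maximal domain in `⨁ᵢ L²(α)`. -/
def mulOp (μ : Measure α) (g : ι × α → ℝ) :
    PiLp 2 (fun _ : ι => Lp ℂ 2 μ) →ₗ.[ℂ] PiLp 2 (fun _ : ι => Lp ℂ 2 μ) :=
  (mulGraph μ g).toLinearPMap

theorem mulOp_graph (g : ι × α → ℝ) : (mulOp μ g).graph = mulGraph μ g :=
  Submodule.toLinearPMap_graph_eq _ (mulGraph_functional g)

theorem mem_mulOp_domain_iff (g : ι × α → ℝ) (ψ : PiLp 2 (fun _ : ι => Lp ℂ 2 μ)) :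
    ψ ∈ (mulOp μ g).domain ↔ ∀ k, MemLp (fun x => (g (k, x) : ℂ) * ψ k x) 2 μ := by
  rw [LinearPMap.mem_domain_iff, mulOp_graph]
  constructor
  · rintro ⟨η, hη⟩ k
    exact (Lp.memLp (η k)).ae_eq (hη k)
  · intro h
    exact ⟨WithLp.toLp 2 fun k => (h k).toLp _, fun k => (h k).coeFn_toLp⟩

theorem coeFn_mulOp (g : ι × α → ℝ) (ψ : (mulOp μ g).domain) (k : ι) :
    mulOp μ g ψ k =ᵐ[μ] fun x => (g (k, x) : ℂ) * (ψ : PiLp 2 (fun _ : ι => Lp ℂ 2 μ)) k x := by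
  have h := LinearPMap.mem_graph (mulOp μ g) ψ
  rw [mulOp_graph] at h
  exact h k

/-- Symmetry of the multiplication operator; it holds because `g` is real. -/
theorem inner_mulOp_graph [Fintype ι] {g : ι × α → ℝ}
    {a b x : PiLp 2 (fun _ : ι => Lp ℂ 2 μ)} {y : PiLp 2 (fun _ : ι => Lp ℂ 2 μ)}
    (hab : (a, b) ∈ mulGraph μ g) (hxy : (x, y) ∈ mulGraph μ g) : ⟪b, x⟫_ℂ = ⟪a, y⟫_ℂ := by
  rw [PiLp.inner_apply, PiLp.inner_apply]
  refine Finset.sum_congr rfl fun k _ => ?_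
  rw [L2.inner_def, L2.inner_def]
  apply integral_congr_ae
  filter_upwards [hab k, hxy k] with t h1 h2
  rw [h1, h2]
  simp only [RCLike.inner_apply, map_mul, Complex.conj_ofReal]
  ring

variable [MeasurableSpace ι]

theorem measurableSet_abs_le {g : ι × α → ℝ} (hg : Measurable g) (N : ℕ) :
    MeasurableSet {y | |g y| ≤ N} :=
  measurableSet_le hg.abs measurable_const

/-- Where `|g| ≤ N`, multiplication by `g` is bounded by `N`. These truncations supply enough
vectors in the domain to test against. -/
theorem sectionProj_mem_mulOp_domain {g : ι × α → ℝ} (hg : Measurable g) (N : ℕ)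
    (ψ : PiLp 2 (fun _ : ι => Lp ℂ 2 μ)) :
    sectionProj μ {y | |g y| ≤ N} ψ ∈ (mulOp μ g).domain := by
  rw [mem_mulOp_domain_iff]
  intro k
  have hgk : Measurable fun x => g (k, x) := hg.comp measurable_prodMk_left
  refine (Lp.memLp (ψ k)).of_le_mul (c := N) ((Complex.measurable_ofReal.comp
    hgk).aestronglyMeasurable.mul (Lp.aestronglyMeasurable _)) ?_
  filter_upwards [coeFn_sectionProj (measurableSet_abs_le hg N) ψ k] with x hx
  rw [hx, norm_mul, Complex.norm_real, Real.norm_eq_abs, Set.indicator]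
  split_ifs with h
  · exact mul_le_mul_of_nonneg_right h (norm_nonneg _)
  · simp only [norm_zero, mul_zero]
    positivity

theorem sectionProj_mulOp {g : ι × α → ℝ} (hg : Measurable g) (N : ℕ)
    (ψ : PiLp 2 (fun _ : ι => Lp ℂ 2 μ)) :
    sectionProj μ {y | |g y| ≤ N}
        (mulOp μ g ⟨sectionProj μ {y | |g y| ≤ N} ψ, sectionProj_mem_mulOp_domain hg N ψ⟩) =
      mulOp μ g ⟨sectionProj μ {y | |g y| ≤ N} ψ, sectionProj_mem_mulOp_domain hg N ψ⟩ := by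
  have hB := measurableSet_abs_le hg N
  ext1 j
  apply Lp.ext
  filter_upwards [coeFn_sectionProj hB (mulOp μ g ⟨_, sectionProj_mem_mulOp_domain hg N ψ⟩) j,
    coeFn_mulOp g ⟨_, sectionProj_mem_mulOp_domain hg N ψ⟩ j, coeFn_sectionProj hB ψ j]
    with t e1 e2 e3
  rw [e1, Set.indicator]
  split_ifs with ht
  · rfl
  · rw [e2, e3, Set.indicator_of_notMem ht, mul_zero]

/-- Since `g` is finite everywhere, the sets `|g| ≤ N` exhaust the space. -/
theorem eq_zero_of_sectionProj_eq_zero {g : ι × α → ℝ} (hg : Measurable g)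
    {ψ : PiLp 2 (fun _ : ι => Lp ℂ 2 μ)}
    (h : ∀ N : ℕ, sectionProj μ {y | |g y| ≤ N} ψ = 0) : ψ = 0 := by
  ext1 k
  apply Lp.ext
  have h1 : ∀ N : ℕ, ∀ᵐ x ∂μ, (Prod.mk k ⁻¹' {y | |g y| ≤ N}).indicator (ψ k) x = 0 := fun N => by
    have h2 := coeFn_sectionProj (measurableSet_abs_le hg N) ψ k
    rw [h N] at h2
    filter_upwards [h2, Lp.coeFn_zero ℂ 2 μ] with x hx h0
    exact hx.symm.trans h0
  filter_upwards [ae_all_iff.2 h1, Lp.coeFn_zero ℂ 2 μ] with x hx h0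
  obtain ⟨N, hN⟩ := exists_nat_ge |g (k, x)|
  have hm : x ∈ Prod.mk k ⁻¹' {y | |g y| ≤ (N : ℝ)} := hN
  exact (Set.indicator_of_mem hm (ψ k)).symm.trans ((hx N).trans h0.symm)

variable [Fintype ι]

/-- A vector orthogonal to the domain is orthogonal to its own truncations, hence zero; so the
domain is dense. A pair in the adjoint relation, tested against truncated vectors, satisfies `x.2 =
g * x.1` almost everywhere on each set `|g| ≤ N`, hence almost everywhere. -/
theorem isSelfAdjoint_mulOp {g : ι × α → ℝ} (hg : Measurable g) : IsSelfAdjoint (mulOp μ g) := by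
  apply isSelfAdjoint_of_mem_graph_iff
  · rw [Submodule.dense_iff_topologicalClosure_eq_top, Submodule.topologicalClosure_eq_top_iff,
      Submodule.eq_bot_iff]
    intro ψ hψ
    refine eq_zero_of_sectionProj_eq_zero hg fun N => ?_
    have h := (Submodule.mem_orthogonal _ _).1 hψ _ (sectionProj_mem_mulOp_domain hg N ψ)
    rw [inner_sectionProj_left (measurableSet_abs_le hg N),
      inner_sectionProj_self (measurableSet_abs_le hg N)] at h
    simpa using h
  · intro x
    rw [mulOp_graph]
    refine ⟨fun hx a b hab => inner_mulOp_graph hab hx, fun hx k => ?_⟩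
    have h1 : ∀ N : ℕ, ∀ᵐ t ∂μ, t ∈ Prod.mk k ⁻¹' {y | |g y| ≤ N} →
        x.2 k t = (g (k, t) : ℂ) * x.1 k t := fun N => by
      have hB := measurableSet_abs_le hg N
      set B := {y | |g y| ≤ (N : ℝ)}
      have hdom := sectionProj_mem_mulOp_domain hg N x.1
      -- Only truncations of the arbitrary vector `χ` may be inserted in `hx`; the projection is
      -- moved across the inner product to produce them.
      have hT : mulOp μ g ⟨sectionProj μ B x.1, hdom⟩ = sectionProj μ B x.2 := by
        refine ext_inner_left ℂ fun χ => ?_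
        have hχ := sectionProj_mem_mulOp_domain hg N χ
        have hg1 := LinearPMap.mem_graph (mulOp μ g) ⟨sectionProj μ B χ, hχ⟩
        have hg2 := LinearPMap.mem_graph (mulOp μ g) ⟨sectionProj μ B x.1, hdom⟩
        rw [mulOp_graph] at hg1 hg2
        rw [← sectionProj_mulOp hg N, ← inner_sectionProj_left hB, ← inner_mulOp_graph hg1 hg2,
          ← inner_sectionProj_left hB, sectionProj_mulOp hg N, hx _ _ hg1,
          inner_sectionProj_left hB]
      filter_upwards [coeFn_sectionProj hB x.2 k, coeFn_sectionProj hB x.1 k,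
        coeFn_mulOp g ⟨sectionProj μ B x.1, hdom⟩ k] with t e1 e2 e3 ht
      rw [hT, e1, e2, Set.indicator_of_mem ht, Set.indicator_of_mem ht] at e3
      exact e3
    filter_upwards [ae_all_iff.2 h1] with t ht
    obtain ⟨N, hN⟩ := exists_nat_ge |g (k, t)|
    exact ht N hN

theorem integrable_multiplicationPVM_measure_iff {h : ι × α → ℝ} (hh : Measurable h)
    (ψ : PiLp 2 (fun _ : ι => Lp ℂ 2 μ)) :
    Integrable h ((multiplicationPVM ι μ).measure ψ) ↔
      ∀ k, Integrable (fun x => ‖ψ k x‖ ^ 2 * h (k, x)) μ := by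
  rw [multiplicationPVM_measure, integrable_finsetSum_measure]
  simp only [Finset.mem_univ, true_imp_iff]
  refine forall_congr' fun k => ?_
  rw [integrable_map_measure hh.aestronglyMeasurable measurable_prodMk_left.aemeasurable,
    integrable_withDensity_iff_integrable_smul₀' (((Lp.aestronglyMeasurable
      (ψ k)).norm.aemeasurable.pow_const 2).ennreal_ofReal)
      (Filter.Eventually.of_forall fun x => ENNReal.ofReal_lt_top)]
  simp

theorem integral_multiplicationPVM_measure {h : ι × α → ℝ} (hh : Measurable h)
    (ψ : PiLp 2 (fun _ : ι => Lp ℂ 2 μ)) (hi : Integrable h ((multiplicationPVM ι μ).measure ψ)) :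
    ∫ y, h y ∂((multiplicationPVM ι μ).measure ψ) = ∑ k, ∫ x, ‖ψ k x‖ ^ 2 * h (k, x) ∂μ := by
  rw [multiplicationPVM_measure] at hi ⊢
  rw [integral_finsetSum_measure fun k _ => integrable_finsetSum_measure.1 hi k (Finset.mem_univ k)]
  refine Finset.sum_congr rfl fun k _ => ?_
  rw [integral_map measurable_prodMk_left.aemeasurable hh.aestronglyMeasurable,
    integral_withDensity_eq_integral_toReal_smul₀ (((Lp.aestronglyMeasurable
      (ψ k)).norm.aemeasurable.pow_const 2).ennreal_ofReal)
      (Filter.Eventually.of_forall fun x => ENNReal.ofReal_lt_top)]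
  simp

theorem isFiniteMeasure_multiplicationPVM_measure (ψ : PiLp 2 (fun _ : ι => Lp ℂ 2 μ)) :
    IsFiniteMeasure ((multiplicationPVM ι μ).measure ψ) :=
  ⟨by rw [PVM.measure_apply _ _ MeasurableSet.univ]; exact ENNReal.ofReal_lt_top⟩

/-- The measure of `ψ` has density `|ψ|²`, so `∫ g² dE_ψ` is the squared norm of `g ψ`, and `∫ g
dE_ψ` is `⟪ψ, g ψ⟫`. -/
theorem isIntegral_mulOp {g : ι × α → ℝ} (hg : Measurable g) :
    (multiplicationPVM ι μ).IsIntegral g (mulOp μ g) := by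
  have hdom : ∀ ψ, ψ ∈ (mulOp μ g).domain ↔ MemLp g 2 ((multiplicationPVM ι μ).measure ψ) := by
    intro ψ
    rw [mem_mulOp_domain_iff, memLp_two_iff_integrable_sq hg.aestronglyMeasurable,
      integrable_multiplicationPVM_measure_iff (hg.pow_const 2)]
    refine forall_congr' fun k => ?_
    have hgk : Measurable fun x => g (k, x) := hg.comp measurable_prodMk_left
    rw [memLp_two_iff_integrable_sq_norm (f := fun x => (g (k, x) : ℂ) * ψ k x) ((Complex.measurable_ofReal.comp
      hgk).aestronglyMeasurable.mul (Lp.aestronglyMeasurable _))]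
    simp only [norm_mul, Complex.norm_real, mul_pow, Real.norm_eq_abs, sq_abs, mul_comm]
  refine ⟨hdom, fun ψ => ?_⟩
  have := isFiniteMeasure_multiplicationPVM_measure (ψ : PiLp 2 (fun _ : ι => Lp ℂ 2 μ))
  -- The measure is finite, so square integrability of `g` implies integrability.
  rw [integral_multiplicationPVM_measure hg _ (((hdom ψ).1 ψ.2).integrable one_le_two),
    PiLp.inner_apply]
  push_cast
  refine Finset.sum_congr rfl fun k _ => ?_
  rw [L2.inner_def, ← integral_complex_ofReal]
  apply integral_congr_ae
  filter_upwards [coeFn_mulOp g ψ k] with x hx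
  rw [hx, RCLike.inner_apply, mul_assoc, RCLike.mul_conj]
  push_cast
  rw [mul_comm]
  rfl

end MultiplicationOp

/-! ### Position, spin and momentum as multiplication operators -/

/-- The fundamental lemma of the calculus of variations: `η` and `h φ` are locally integrable, and
smooth compactly supported functions, which are Schwartz, separate such functions up to null sets.
-/
theorem smulLeftCLM_toTemperedDistribution_eq_iff {h : R3 → ℂ} (hh : h.HasTemperateGrowth)
    (φ η : L2R3) :
    TemperedDistribution.smulLeftCLM ℂ h (Lp.toTemperedDistribution φ) =
        Lp.toTemperedDistribution η ↔
      η =ᵐ[volume] fun x => h x * φ x := by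
  have hc : Continuous h := hh.1.continuous
  constructor
  · intro H
    have h1 : LocallyIntegrable φ volume := (Lp.memLp φ).locallyIntegrable one_le_two
    have h2 : LocallyIntegrable η volume := (Lp.memLp η).locallyIntegrable one_le_two
    have h3 : LocallyIntegrable (fun x => h x * φ x) volume := h1.continuous_mul hc
    have h4 : ∀ᵐ x ∂(volume : Measure R3), η x - h x * φ x = 0 := by
      refine ae_eq_zero_of_integral_contDiff_smul_eq_zero (f := fun x => η x - h x * φ x)
        (h2.sub h3) fun u hu hcu => ?_
      have hu1 : HasCompactSupport (Complex.ofRealCLM ∘ u) := hcu.comp_left rfl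
      have hu2 : ContDiff ℝ (⊤ : ℕ∞) (Complex.ofRealCLM ∘ u) := by fun_prop
      have h5 := congrArg (fun T : 𝓢'(R3, ℂ) => T (hu1.toSchwartzMap hu2)) H
      simp only [TemperedDistribution.smulLeftCLM_apply_apply,
        Lp.toTemperedDistribution_apply, SchwartzMap.smulLeftCLM_apply_apply hh] at h5
      simp only [smul_sub]
      rw [integral_sub (h2.integrable_smul_left_of_hasCompactSupport hu.continuous hcu)
        (h3.integrable_smul_left_of_hasCompactSupport hu.continuous hcu), sub_eq_zero]
      refine Eq.trans ?_ (h5.symm.trans ?_)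
      · exact integral_congr_ae (Filter.Eventually.of_forall fun x => by simp)
      · exact integral_congr_ae (Filter.Eventually.of_forall fun x => by simp; ring)
    filter_upwards [h4] with x hx using sub_eq_zero.1 hx
  · intro H
    ext u
    simp only [TemperedDistribution.smulLeftCLM_apply_apply,
        Lp.toTemperedDistribution_apply, SchwartzMap.smulLeftCLM_apply_apply hh]
    apply integral_congr_ae
    filter_upwards [H] with x hx
    rw [hx]
    simp only [smul_eq_mul]
    ring

/-- The Fourier transform is injective on tempered distributions and turns `∂_j` into multiplication
by `2πi p_j`; the factor `i` cancels. -/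
theorem lineDeriv_toTemperedDistribution_eq_iff (j : Fin 3) (φ η : L2R3) :
    ∂_{EuclideanSpace.single j (1 : ℝ)} (Lp.toTemperedDistribution φ) =
        Complex.I • Lp.toTemperedDistribution η ↔
      (𝓕 η : L2R3) =ᵐ[volume] fun p => ((2 * Real.pi * p j : ℝ) : ℂ) * (𝓕 φ : L2R3) p := by
  have hgr : (fun p : R3 => ((inner ℝ p (EuclideanSpace.single j (1 : ℝ)) : ℝ) : ℂ)).HasTemperateGrowth := by
    fun_prop
  have hinj : Function.Injective (𝓕 : 𝓢'(R3, ℂ) → 𝓢'(R3, ℂ)) :=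
    Function.LeftInverse.injective fun T => FourierTransform.fourierInv_fourier_eq T
  have h2 : ((2 * Real.pi : ℂ) • fun p : R3 =>
      ((inner ℝ p (EuclideanSpace.single j (1 : ℝ)) : ℝ) : ℂ)) =
      fun p : R3 => ((2 * Real.pi * p j : ℝ) : ℂ) := by
    ext p
    simp [PiLp.inner_apply]
  have hgr2 : (fun p : R3 => ((2 * Real.pi * p j : ℝ) : ℂ)).HasTemperateGrowth := by
    rw [← h2]
    exact (Function.HasTemperateGrowth.const (2 * Real.pi : ℂ)).mul hgr
  rw [← smulLeftCLM_toTemperedDistribution_eq_iff hgr2, ← h2,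
    TemperedDistribution.smulLeftCLM_smul hgr, ← hinj.eq_iff,
    TemperedDistribution.fourier_lineDerivOp_eq, FourierTransform.fourier_smul,
    Lp.fourier_toTemperedDistribution_eq, Lp.fourier_toTemperedDistribution_eq,
    mul_comm (2 * Real.pi : ℂ), mul_smul, smul_right_inj Complex.I_ne_zero]
  rfl

/-- The componentwise Fourier transform on the Hilbert space of the particle. -/
def spinFourier (n : ℕ) : SpinSpace n ≃ₗᵢ[ℂ] SpinSpace n :=
  LinearIsometryEquiv.piLpCongrRight 2 fun _ => Lp.fourierTransformₗᵢ R3 ℂ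

theorem positionOp_eq_mulOp (n : ℕ) (j : Fin 3) :
    positionOp n j = mulOp volume fun y : Fin (n + 1) × R3 => y.2 j := by
  apply LinearPMap.eq_of_eq_graph
  rw [positionOp_graph, mulOp_graph]
  rfl

theorem momentumOp_eq_conjOp (n : ℕ) (j : Fin 3) :
    momentumOp n j = conjOp (mulOp volume fun y : Fin (n + 1) × R3 => 2 * Real.pi * y.2 j)
      (spinFourier n) := by
  apply LinearPMap.eq_of_eq_graph
  rw [momentumOp_graph, conjOp_graph]
  ext a
  rw [mem_conjGraph, mulOp_graph, mem_mulGraph]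
  exact forall_congr' fun k => lineDeriv_toTemperedDistribution_eq_iff j (a.1 k) (a.2 k)

theorem spinOp_eq_mulOp (n : ℕ) :
    spinOp n = mulOp volume fun y : Fin (n + 1) × R3 => spinValue n y.1 := by
  apply LinearPMap.eq_of_eq_graph
  rw [mulOp_graph]
  ext a
  rw [mem_mulGraph, LinearPMap.mem_graph_iff]
  have key : ∀ k, (a.2 k =ᵐ[volume] fun x => ((spinValue n k : ℝ) : ℂ) * a.1 k x) ↔
      ((spinValue n k : ℝ) : ℂ) • a.1 k = a.2 k := fun k => by
    rw [eq_comm, Lp.ext_iff]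
    have h := Lp.coeFn_smul ((spinValue n k : ℝ) : ℂ) (a.1 k)
    exact ⟨fun H => H.trans h.symm, fun H => H.trans h⟩
  simp only [key]
  constructor
  · rintro ⟨y, h1, h2⟩ k
    rw [← h1, ← h2]
    rfl
  · intro h
    refine ⟨⟨a.1, trivial⟩, rfl, ?_⟩
    ext1 k
    exact h k

/-! ### Marginals of the measure of a state -/

section Marginals

variable {α β : Type*} [MeasurableSpace α] [MeasurableSpace β]

theorem measure_map_finsetSum {ι : Type*} (s : Finset ι) (m : ι → Measure α) {f : α → β}
    (hf : Measurable f) : (∑ i ∈ s, m i).map f = ∑ i ∈ s, (m i).map f := by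
  simp only [← Measure.mapₗ_apply_of_measurable hf, map_sum]

theorem map_fst_withDensity_mul {μ : Measure α} {ν : Measure β} [SFinite μ] [SFinite ν]
    {a : α → ENNReal} {b : β → ENNReal} (ha : AEMeasurable a μ) (hb : AEMeasurable b ν) :
    ((μ.prod ν).withDensity fun z => a z.1 * b z.2).map Prod.fst =
      (∫⁻ y, b y ∂ν) • μ.withDensity a := by
  ext A hA
  rw [Measure.map_apply measurable_fst hA, withDensity_apply _ (measurable_fst hA),
    Measure.smul_apply, withDensity_apply _ hA, ← Set.prod_univ, ← Measure.prod_restrict,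
    Measure.restrict_univ, lintegral_prod_mul ha.restrict hb, smul_eq_mul, mul_comm]

theorem map_snd_withDensity_mul {μ : Measure α} {ν : Measure β} [SFinite μ] [SFinite ν]
    {a : α → ENNReal} {b : β → ENNReal} (ha : AEMeasurable a μ) (hb : AEMeasurable b ν) :
    ((μ.prod ν).withDensity fun z => a z.1 * b z.2).map Prod.snd =
      (∫⁻ x, a x ∂μ) • ν.withDensity b := by
  ext A hA
  rw [Measure.map_apply measurable_snd hA, withDensity_apply _ (measurable_snd hA),
    Measure.smul_apply, withDensity_apply _ hA, ← Set.univ_prod, ← Measure.prod_restrict,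
    Measure.restrict_univ, lintegral_prod_mul ha hb.restrict, smul_eq_mul]

theorem lintegral_norm_sq_Lp {μ : Measure α} (f : Lp ℂ 2 μ) :
    ∫⁻ x, ENNReal.ofReal (‖f x‖ ^ 2) ∂μ = ENNReal.ofReal (‖f‖ ^ 2) := by
  rw [← ofReal_integral_eq_lintegral_ofReal ((memLp_two_iff_integrable_sq_norm
    (Lp.aestronglyMeasurable _)).1 (Lp.memLp f)) (Filter.Eventually.of_forall fun x => by positivity)]
  congr 1
  apply Complex.ofReal_injective
  have h := inner_self_eq_norm_sq_to_K (𝕜 := ℂ) f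
  rw [L2.inner_def] at h
  push_cast
  refine Eq.trans ?_ h
  rw [← integral_complex_ofReal]
  congr 1 with x
  rw [inner_self_eq_norm_sq_to_K]
  push_cast
  rfl

theorem aemeasurable_norm_sq_Lp {μ : Measure α} (f : Lp ℂ 2 μ) :
    AEMeasurable (fun x => ENNReal.ofReal (‖f x‖ ^ 2)) μ :=
  ((Lp.aestronglyMeasurable f).norm.aemeasurable.pow_const 2).ennreal_ofReal

theorem aemeasurable_unitaryFourier (φ : L2R3) : AEMeasurable (unitaryFourier φ) volume := by
  have hpi : (2 * Real.pi)⁻¹ ≠ 0 := by positivity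
  exact ((Lp.aestronglyMeasurable (𝓕 φ : L2R3)).aemeasurable.comp_quasiMeasurePreserving
    (Measure.quasiMeasurePreserving_smul (volume : Measure R3) hpi)).const_mul _

theorem norm_unitaryFourier_sq (φ : L2R3) (p : R3) :
    ‖unitaryFourier φ p‖ ^ 2 = ((2 * Real.pi) ^ 3)⁻¹ * ‖(𝓕 φ : L2R3) ((2 * Real.pi)⁻¹ • p)‖ ^ 2 := by
  have h0 : (0 : ℝ) ≤ 2 * Real.pi := by positivity
  rw [unitaryFourier, norm_mul, mul_pow, Complex.norm_real, Real.norm_eq_abs, sq_abs,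
    ← Real.rpow_natCast, ← Real.rpow_mul h0]
  congr 1
  norm_num

/-- Substitution `p = 2πξ`: the Jacobian of the dilation on `ℝ³` absorbs the factor `(2π)⁻³` of
`norm_unitaryFourier_sq`. -/
theorem withDensity_unitaryFourier (φ : L2R3) :
    ((volume : Measure R3).withDensity fun p => ENNReal.ofReal (‖unitaryFourier φ p‖ ^ 2)) =
      (volume.withDensity fun p => ENNReal.ofReal (‖(𝓕 φ : L2R3) p‖ ^ 2)).map
        fun p => (2 * Real.pi) • p := by
  have hpi : (2 * Real.pi) ≠ 0 := by positivity
  let e : R3 ≃ᵐ R3 := (Homeomorph.smulOfNeZero (2 * Real.pi) hpi).toMeasurableEquiv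
  have he : ∀ p, e p = (2 * Real.pi) • p := fun p => rfl
  have hvol : (volume : Measure R3).map e = ENNReal.ofReal ((2 * Real.pi) ^ 3)⁻¹ • volume := by
    have h := Measure.map_addHaar_smul (volume : Measure R3) hpi
    rw [finrank_euclideanSpace_fin, abs_of_pos (by positivity)] at h
    exact h
  change _ = Measure.map e _
  ext B hB
  rw [e.map_apply, withDensity_apply _ hB, withDensity_apply _ (e.measurable hB)]
  have h1 : ∀ p, ENNReal.ofReal (‖unitaryFourier φ p‖ ^ 2) =
      ENNReal.ofReal ((2 * Real.pi) ^ 3)⁻¹ *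
        ENNReal.ofReal (‖(𝓕 φ : L2R3) ((2 * Real.pi)⁻¹ • p)‖ ^ 2) := fun p => by
    rw [norm_unitaryFourier_sq, ENNReal.ofReal_mul (by positivity)]
  simp only [h1]
  rw [lintegral_const_mul' _ _ ENNReal.ofReal_ne_top, ← smul_eq_mul, ← lintegral_smul_measure,
    ← Measure.restrict_smul, ← hvol, e.restrict_map, lintegral_map_equiv]
  simp only [he, inv_smul_smul₀ hpi]

theorem lintegral_norm_sq_unitaryFourier (φ : L2R3) :
    ∫⁻ p, ENNReal.ofReal (‖unitaryFourier φ p‖ ^ 2) = ENNReal.ofReal (‖φ‖ ^ 2) := by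
  rw [← setLIntegral_univ, ← withDensity_apply _ MeasurableSet.univ, withDensity_unitaryFourier,
    Measure.map_apply (measurable_const_smul _) MeasurableSet.univ, Set.preimage_univ,
    withDensity_apply _ MeasurableSet.univ, setLIntegral_univ, lintegral_norm_sq_Lp,
    Lp.norm_fourier_eq]

theorem aemeasurable_norm_sq_unitaryFourier (φ : L2R3) :
    AEMeasurable (fun x => ENNReal.ofReal (‖unitaryFourier φ x‖ ^ 2)) volume :=
  ((aemeasurable_unitaryFourier φ).norm.pow_const 2).ennreal_ofReal

/-- The measure on phase space which a component `φ` of a state contributes. -/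
def sheetMeasure (φ : L2R3) : Measure (R3 × R3) :=
  volume.withDensity fun z =>
    ENNReal.ofReal ((‖φ‖ ^ 2)⁻¹ * (‖φ z.1‖ ^ 2 * ‖unitaryFourier φ z.2‖ ^ 2))

theorem sheetMeasure_eq (φ : L2R3) :
    sheetMeasure φ = ENNReal.ofReal (‖φ‖ ^ 2)⁻¹ •
      ((volume : Measure R3).prod (volume : Measure R3)).withDensity fun z =>
        ENNReal.ofReal (‖φ z.1‖ ^ 2) * ENNReal.ofReal (‖unitaryFourier φ z.2‖ ^ 2) := by
  rw [sheetMeasure, ← withDensity_smul' _ _ ENNReal.ofReal_ne_top, Measure.volume_eq_prod]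
  congr 1 with z
  rw [ENNReal.ofReal_mul (by positivity), ENNReal.ofReal_mul (by positivity), Pi.smul_apply,
    smul_eq_mul]

/-- With `0⁻¹ = 0` the density vanishes, so the sum over nonzero components may run over all of
them. -/
theorem sheetMeasure_zero : sheetMeasure 0 = 0 := by
  simp [sheetMeasure]

theorem ofReal_inv_smul_ofReal_smul {φ : L2R3} (hφ : φ ≠ 0) (m : Measure α) :
    ENNReal.ofReal (‖φ‖ ^ 2)⁻¹ • ENNReal.ofReal (‖φ‖ ^ 2) • m = m := by
  have h : (0 : ℝ) < ‖φ‖ ^ 2 := by positivity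
  rw [smul_smul, ← ENNReal.ofReal_mul (by positivity), inv_mul_cancel₀ h.ne', ENNReal.ofReal_one,
    one_smul]

/-- Tonelli and Plancherel: the momentum factor integrates to `‖φ‖²`, which the normalization
cancels. For `φ = 0` both sides vanish. -/
theorem map_fst_sheetMeasure (φ : L2R3) :
    (sheetMeasure φ).map Prod.fst = volume.withDensity fun x => ENNReal.ofReal (‖φ x‖ ^ 2) := by
  rcases eq_or_ne φ 0 with rfl | hφ
  · rw [sheetMeasure_zero, Measure.map_zero, eq_comm, ← Measure.measure_univ_eq_zero,
      withDensity_apply _ MeasurableSet.univ, setLIntegral_univ, lintegral_norm_sq_Lp]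
    simp
  · rw [sheetMeasure_eq, Measure.map_smul, map_fst_withDensity_mul (aemeasurable_norm_sq_Lp φ)
      (aemeasurable_norm_sq_unitaryFourier φ), lintegral_norm_sq_unitaryFourier,
      ofReal_inv_smul_ofReal_smul hφ]

theorem map_snd_sheetMeasure (φ : L2R3) :
    (sheetMeasure φ).map Prod.snd =
      volume.withDensity fun x => ENNReal.ofReal (‖unitaryFourier φ x‖ ^ 2) := by
  rcases eq_or_ne φ 0 with rfl | hφ
  · rw [sheetMeasure_zero, Measure.map_zero, eq_comm, ← Measure.measure_univ_eq_zero,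
      withDensity_apply _ MeasurableSet.univ, setLIntegral_univ, lintegral_norm_sq_unitaryFourier]
    simp
  · rw [sheetMeasure_eq, Measure.map_smul, map_snd_withDensity_mul (aemeasurable_norm_sq_Lp φ)
      (aemeasurable_norm_sq_unitaryFourier φ), lintegral_norm_sq_Lp,
      ofReal_inv_smul_ofReal_smul hφ]

theorem vectorMeasure_eq_sum (n : ℕ) (ψ : SpinSpace n) :
    vectorMeasure n ψ = ∑ k, (sheetMeasure (ψ k)).map (Prod.mk k) := by
  rw [vectorMeasure, Finset.sum_filter]
  refine Finset.sum_congr rfl fun k _ => ?_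
  split_ifs with h
  · rfl
  · rw [not_not.1 h, sheetMeasure_zero, Measure.map_zero]

/-- Keeping the spin label makes this single marginal serve both position and spin. -/
theorem map_position_vectorMeasure (n : ℕ) (ψ : SpinSpace n) :
    (vectorMeasure n ψ).map (fun z => (z.1, z.2.1)) =
      (multiplicationPVM (Fin (n + 1)) (volume : Measure R3)).measure ψ := by
  rw [vectorMeasure_eq_sum, multiplicationPVM_measure, measure_map_finsetSum _ _ (by fun_prop)]
  refine Finset.sum_congr rfl fun k _ => ?_
  rw [← map_fst_sheetMeasure, Measure.map_map (by fun_prop) (by fun_prop),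
    Measure.map_map (by fun_prop) (by fun_prop)]
  rfl

theorem map_momentum_vectorMeasure (n : ℕ) (ψ : SpinSpace n) :
    (vectorMeasure n ψ).map (fun z => (z.1, z.2.2)) =
      ((multiplicationPVM (Fin (n + 1)) (volume : Measure R3)).measure (spinFourier n ψ)).map
        fun y => (y.1, (2 * Real.pi) • y.2) := by
  rw [vectorMeasure_eq_sum, multiplicationPVM_measure, measure_map_finsetSum _ _ (by fun_prop),
    measure_map_finsetSum _ _ (by fun_prop)]
  refine Finset.sum_congr rfl fun k _ => ?_
  have h := (map_snd_sheetMeasure (ψ k)).trans (withDensity_unitaryFourier (ψ k))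
  have h2 := congrArg (Measure.map (Prod.mk k)) h
  rw [Measure.map_map (by fun_prop) (by fun_prop), Measure.map_map (by fun_prop) (by fun_prop)] at h2
  rw [Measure.map_map (by fun_prop) (by fun_prop), Measure.map_map (by fun_prop) (by fun_prop)]
  exact h2

theorem isProbabilityMeasure_vectorMeasure (n : ℕ) (ψ : SpinSpace n) (hψ : ‖ψ‖ = 1) :
    IsProbabilityMeasure (vectorMeasure n ψ) := by
  constructor
  -- A pushforward preserves total mass, and the mass of the image is `⟪ψ, ψ⟫ = 1`.
  have h := congrArg (fun m : Measure (Fin (n + 1) × R3) => m Set.univ)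
    (map_position_vectorMeasure n ψ)
  rw [Measure.map_apply (by fun_prop) MeasurableSet.univ, Set.preimage_univ,
    PVM.measure_apply _ _ MeasurableSet.univ, PVM.proj_univ, one_apply_eq_self,
    inner_self_eq_norm_sq_to_K, hψ] at h
  simpa using h

theorem vectorMeasure_singleton (n : ℕ) (ψ : SpinSpace n) (z : LabelSpace n) :
    vectorMeasure n ψ {z} = 0 := by
  rw [vectorMeasure_eq_sum, Measure.finsetSum_apply]
  refine Finset.sum_eq_zero fun k _ => ?_
  rw [Measure.map_apply (by fun_prop) (measurableSet_singleton z)]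
  have : NullSingletonClass (volume : Measure (R3 × R3)) := by
    rw [Measure.volume_eq_prod]
    infer_instance
  refine measure_mono_null (t := {z.2}) (fun w hw => congrArg Prod.snd hw) ?_
  exact withDensity_absolutelyContinuous _ _ (measure_singleton z.2)

end Marginals

/-! ### Observable functions -/

theorem PVM.isObservableFunction_of_isIntegral {H X Z : Type*} [NormedAddCommGroup H]
    [InnerProductSpace ℂ H] [CompleteSpace H] [MeasurableSpace X] [MeasurableSpace Z]
    (E : PVM X H) {g : X → ℝ} (hg : Measurable g) {A : H →ₗ.[ℂ] H} (hA : IsSelfAdjoint A)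
    (hE : E.IsIntegral g A) {m : ℙ ℂ H → Measure Z} {f : Z → X} (hf : Measurable f)
    (hm : ∀ (ψ : H) (hψ : ψ ≠ 0), ‖ψ‖ = 1 → (m (Projectivization.mk ℂ ψ hψ)).map f = E.measure ψ) :
    IsObservableFunction m (fun _ z => g (f z)) A := by
  -- The spectral measure of `∫ g dE` is the image of `E` under `g`.
  refine ⟨fun _ => hg.comp hf, hA, E.map g hg, (E.isIntegral_map_iff hg measurable_id A).2 hE,
    fun ψ hψ h1 => ?_⟩
  rw [E.map_measure hg, ← hm ψ hψ h1, Measure.map_map hg hf]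
  rfl

/-- The projection-valued measure of spin and position. -/
def positionPVM (n : ℕ) : PVM (Fin (n + 1) × R3) (SpinSpace n) :=
  multiplicationPVM (Fin (n + 1)) volume

theorem measurable_momentumScaling (n : ℕ) :
    Measurable fun y : Fin (n + 1) × R3 => (y.1, (2 * Real.pi) • y.2) := by
  fun_prop

/-- The projection-valued measure of spin and momentum. -/
def momentumPVM (n : ℕ) : PVM (Fin (n + 1) × R3) (SpinSpace n) :=
  ((positionPVM n).map _ (measurable_momentumScaling n)).conj (spinFourier n)

theorem isIntegral_momentumPVM (n : ℕ) {g : Fin (n + 1) × R3 → ℝ} (hg : Measurable g) :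
    (momentumPVM n).IsIntegral g
      (conjOp (mulOp volume fun y => g (y.1, (2 * Real.pi) • y.2)) (spinFourier n)) :=
  (((positionPVM n).isIntegral_map_iff (measurable_momentumScaling n) hg _).2
    (isIntegral_mulOp (hg.comp (measurable_momentumScaling n)))).conj _

theorem stateMeasure_map_position (n : ℕ) (ψ : SpinSpace n) (hψ : ψ ≠ 0) (h1 : ‖ψ‖ = 1) :
    (stateMeasure n (Projectivization.mk ℂ ψ hψ)).map (fun z => (z.1, z.2.1)) =
      (positionPVM n).measure ψ := by
  rw [stateMeasure_mk n ψ hψ h1, map_position_vectorMeasure, positionPVM]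

theorem stateMeasure_map_momentum (n : ℕ) (ψ : SpinSpace n) (hψ : ψ ≠ 0) (h1 : ‖ψ‖ = 1) :
    (stateMeasure n (Projectivization.mk ℂ ψ hψ)).map (fun z => (z.1, z.2.2)) =
      (momentumPVM n).measure ψ := by
  rw [stateMeasure_mk n ψ hψ h1, map_momentum_vectorMeasure, momentumPVM, PVM.conj_measure,
    PVM.map_measure, positionPVM]

end SpinPhaseSpace

end

/-! ### The theorem on momentum, position and spin. -/

theorem mainTheorem3 (n : ℕ) :
    (∀ v : ℙ ℂ (SpinSpace n), IsProbabilityMeasure (stateMeasure n v) ∧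
      ∀ z : LabelSpace n, stateMeasure n v {z} = 0) ∧
    (∀ f : R3 → ℝ, Measurable f → ∃ A : SpinSpace n →ₗ.[ℂ] SpinSpace n,
      IsBorelFunctionOf (momentumOp n) f A ∧
      IsObservableFunction (stateMeasure n) (fun _ z => f z.2.2) A) ∧
    (∀ g : R3 → ℝ, Measurable g → ∃ A : SpinSpace n →ₗ.[ℂ] SpinSpace n,
      IsBorelFunctionOf (positionOp n) g A ∧
      IsObservableFunction (stateMeasure n) (fun _ z => g z.2.1) A) ∧
    IsObservableFunction (stateMeasure n) (fun _ z => spinValue n z.1) (spinOp n) := by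
  have hcoord : ∀ j : Fin 3, Measurable fun x : R3 => x j := fun j => by fun_prop
  refine ⟨fun v => ⟨?_, fun z => vectorMeasure_singleton n _ z⟩, fun f hf => ?_, fun g hg => ?_, ?_⟩
  · apply isProbabilityMeasure_vectorMeasure
    have h : ‖v.rep‖ ≠ 0 := norm_ne_zero_iff.2 v.rep_nonzero
    rw [norm_smul, Complex.norm_real, norm_inv, norm_norm, inv_mul_cancel₀ h]
  · have hfs : Measurable fun y : Fin (n + 1) × R3 => f y.2 := hf.comp measurable_snd
    -- The joint spectral measure of the momenta forgets the spin label; the operator is the Fourier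
    -- conjugate of multiplication by `f (2π p)`.
    refine ⟨_, ⟨(momentumPVM n).map Prod.snd measurable_snd, fun j => ?_,
      ((momentumPVM n).isIntegral_map_iff measurable_snd hf _).2 (isIntegral_momentumPVM n hfs)⟩,
      (momentumPVM n).isObservableFunction_of_isIntegral hfs (isSelfAdjoint_conjOp
        (isSelfAdjoint_mulOp (hfs.comp (measurable_momentumScaling n))) _)
        (isIntegral_momentumPVM n hfs) (f := fun z : LabelSpace n => (z.1, z.2.2)) (by fun_prop)
        (stateMeasure_map_momentum n)⟩
    rw [momentumOp_eq_conjOp]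
    exact ((momentumPVM n).isIntegral_map_iff measurable_snd (hcoord j) _).2
      (isIntegral_momentumPVM n ((hcoord j).comp measurable_snd))
  · have hgs : Measurable fun y : Fin (n + 1) × R3 => g y.2 := hg.comp measurable_snd
    refine ⟨_, ⟨(positionPVM n).map Prod.snd measurable_snd, fun j => ?_,
      ((positionPVM n).isIntegral_map_iff measurable_snd hg _).2 (isIntegral_mulOp hgs)⟩,
      (positionPVM n).isObservableFunction_of_isIntegral hgs (isSelfAdjoint_mulOp hgs)
        (isIntegral_mulOp hgs) (f := fun z : LabelSpace n => (z.1, z.2.1)) (by fun_prop)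
        (stateMeasure_map_position n)⟩
    rw [positionOp_eq_mulOp]
    exact ((positionPVM n).isIntegral_map_iff measurable_snd (hcoord j) _).2
      (isIntegral_mulOp ((hcoord j).comp measurable_snd))
  · have hs : Measurable fun y : Fin (n + 1) × R3 => spinValue n y.1 :=
      (measurable_of_finite (spinValue n)).comp measurable_fst
    rw [spinOp_eq_mulOp]
    exact (positionPVM n).isObservableFunction_of_isIntegral hs (isSelfAdjoint_mulOp hs)
      (isIntegral_mulOp hs) (f := fun z : LabelSpace n => (z.1, z.2.1)) (by fun_prop)
      (stateMeasure_map_position n)
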